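/- Let $\mathcal A$ be a (possibly infinite) set of agents, $\mathcal G$ an arbitrary set of nonempty subsets of $\mathcal A$, and $\Phi$ a set of primitive propositions. The formulas of $\mathcal L^C_{\mathcal G}$ are built from $\Phi$ by $\land$, $\neg$, $K_i$ ($i\in\mathcal A$), and $E_G$, $C_G$ ($G\in\mathcal G$); $\varphi\Rightarrow\psi$ abbreviates $\neg(\varphi\land\neg\psi)$ and $\mathit{false}$ abbreviates a contradiction $\varphi\land\neg\varphi$. A Kripke structure $M$ consists of a set $S$ of states, a truth assignment $\pi(s)$ to $\Phi$ for each $s\in S$, and a binary relation $\mathcal K_i$ on $S$ for each $i\in\mathcal A$. Truth $(M,s)\models\varphi$ is defined as usual for propositions, $\land$ and $\neg$; $(M,s)\models K_i\varphi$ iff $(M,t)\models\varphi$ for all $t$ with $(s,t)\in\mathcal K_i$; $(M,s)\models E_G\varphi$ iff $(M,s)\models K_i\varphi$ for all $i\in G$; and $(M,s)\models C_G\varphi$ iff $(M,s)\models E_G^k\varphi$ for all $k\ge 1$, where $E_G^1\varphi=E_G\varphi$ and $E_G^{k+1}\varphi=E_GE_G^k\varphi$. A formula is valid in a class of structures if it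 is true at every state of every structure in the class. Consider the following axiom schemes and rules, for all formulas $\varphi,\psi$, all $i\in\mathcal A$ and all $G\in\mathcal G$. - Prop: all substitution instances of propositional tautologies. - K1: $(K_i\varphi\land K_i(\varphi\Rightarrow\psi))\Rightarrow K_i\psi$. - K2: $K_i\varphi\Rightarrow\varphi$. - K3: $\neg K_i\,\mathit{false}$. - K4: $K_i\varphi\Rightarrow K_iK_i\varphi$. - K5: $\neg K_i\varphi\Rightarrow K_i\neg K_i\varphi$. - E1: $E_G\varphi\Rightarrow K_i\varphi$ if $i\in G$. - E2: $\big(\bigwedge_{i\in\mathcal A'}K_i\varphi\land\bigwedge_{G'\in\mathcal G'}E_{G'}\varphi\big)\Rightarrow E_G\varphi$ if $\mathcal A'\subseteq\mathcal A$ and $\mathcal G'\subseteq\mathcal G$ are finite and $G\subseteq\mathcal A'\cup\bigcup\mathcal G'$. - E3: $(E_G\varphi\land E_G(\varphi\Rightarrow\psi))\Rightarrow E_G\psi$. - E4: $E_G(E_G\varphi\Rightarrow\varphi)$. - E6: $\neg\varphi\Rightarrow E_G\neg E_G\varphi$. - C1: $C_G\varphi\Rightarrow E_G(\varphi\land C_G\varphi)$.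 - MP: from $\varphi$ and $\varphi\Rightarrow\psi$ infer $\psi$. - KGen: from $\varphi$ infer $K_i\varphi$. - EGen: from $\varphi$ infer $E_G\varphi$. - RC1: from $\varphi\Rightarrow E_G(\psi\land\varphi)$ infer $\varphi\Rightarrow C_G\psi$. Let $\mathrm K_{\mathcal G}^C$ consist of Prop, K1, E1, E2, E3, C1 and the rules MP, KGen, EGen, RC1. Let $\mathrm T_{\mathcal G}^C$ be $\mathrm K_{\mathcal G}^C$ with K2 added; $\mathrm{S4}_{\mathcal G}^C$ be $\mathrm K_{\mathcal G}^C$ with K2 and K4 added; $\mathrm{S5}_{\mathcal G}^C$ be $\mathrm K_{\mathcal G}^C$ with K2, K4, K5 and E6 added; and $\mathrm{KD45}_{\mathcal G}^C$ be $\mathrm K_{\mathcal G}^C$ with K3, K4, K5 and E4 added. **Theorem.** For formulas of $\mathcal L^C_{\mathcal G}$, each of the following systems is sound and complete for the given class of Kripke structures; that is, a formula is provable in the system if and only if it is valid in the class: (a) $\mathrm K_{\mathcal G}^C$, for all structures; (b) $\mathrm T_{\mathcal G}^C$, for structures in which every $\mathcal K_i$ is reflexive; (c) $\mathrm{S4}_{\mathcal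 G}^C$, for structures in which every $\mathcal K_i$ is reflexive and transitive; (d) $\mathrm{S5}_{\mathcal G}^C$, for structures in which every $\mathcal K_i$ is reflexive, symmetric and transitive; (e) $\mathrm{KD45}_{\mathcal G}^C$, for structures in which every $\mathcal K_i$ is Euclidean ($(s,t),(s,u)\in\mathcal K_i$ implies $(t,u)\in\mathcal K_i$), serial (for every $s$ there is $t$ with $(s,t)\in\mathcal K_i$) and transitive. -/

import Mathlib

/-! # Epistemic logic with common knowledge over a possibly infinite set of agents -/

universe u v w

namespace CK

/-- Formulas over primitive propositions `Φ`, agents `𝒜` and a family `𝒢` of groups of agents: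
the closure of `Φ` under `∧`, `¬`, `K_i` (`i : 𝒜`), `E_G` and `C_G` (`G ∈ 𝒢`). -/
inductive Form (Φ : Type u) (𝒜 : Type v) (𝒢 : Set (Set 𝒜)) : Type (max u v)
  | atom : Φ → Form Φ 𝒜 𝒢
  | and : Form Φ 𝒜 𝒢 → Form Φ 𝒜 𝒢 → Form Φ 𝒜 𝒢
  | neg : Form Φ 𝒜 𝒢 → Form Φ 𝒜 𝒢
  | K : 𝒜 → Form Φ 𝒜 𝒢 → Form Φ 𝒜 𝒢
  | E : 𝒢 → Form Φ 𝒜 𝒢 → Form Φ 𝒜 𝒢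
  | C : 𝒢 → Form Φ 𝒜 𝒢 → Form Φ 𝒜 𝒢

/-- Kripke structures over `𝒜` and `Φ`: `rel i s t` means `(s, t) ∈ 𝒦_i`. -/
structure Kripke (Φ : Type u) (𝒜 : Type v) where
  State : Type w
  val : State → Φ → Prop
  rel : 𝒜 → State → State → Prop

/-- `M.everyone G X` is the set of states all of whose `𝒦_i`-successors, for every `i ∈ G`,
lie in `X`. -/
def Kripke.everyone {Φ : Type u} {𝒜 : Type v} (M : Kripke.{u, v, w} Φ 𝒜) (G : Set 𝒜)
    (X : Set M.State) : Set M.State :=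
  {s | ∀ i ∈ G, ∀ t, M.rel i s t → t ∈ X}

/-- The truth relation `(M, s) ⊨ φ`. In the last clause `(M.everyone G)^[k + 1]`, applied to the
set of states where `φ` is true, is the set of states where `E_G^{k+1} φ` is true, so that
`C_G φ` says that `E_G^k φ` is true for `k = 1, 2, 3, …`. -/
def Kripke.Sat {Φ : Type u} {𝒜 : Type v} {𝒢 : Set (Set 𝒜)} (M : Kripke.{u, v, w} Φ 𝒜) :
    Form Φ 𝒜 𝒢 → M.State → Prop
  | .atom p, s => M.val s p
  | .and φ ψ, s => M.Sat φ s ∧ M.Sat ψ s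
  | .neg φ, s => ¬ M.Sat φ s
  | .K i φ, s => ∀ t, M.rel i s t → M.Sat φ t
  | .E G φ, s => ∀ i ∈ G.1, ∀ t, M.rel i s t → M.Sat φ t
  | .C G φ, s => ∀ k : ℕ, s ∈ (M.everyone G.1)^[k + 1] {t | M.Sat φ t}

/-- Validity of a formula in a class of structures. -/
def Valid {Φ : Type u} {𝒜 : Type v} {𝒢 : Set (Set 𝒜)} (𝓜 : Set (Kripke.{u, v, w} Φ 𝒜))
    (φ : Form Φ 𝒜 𝒢) : Prop :=
  ∀ M ∈ 𝓜, ∀ s : M.State, M.Sat φ s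

/-! ## Classes of structures -/

/-- All structures. -/
def classAll (Φ : Type u) (𝒜 : Type v) : Set (Kripke.{u, v, w} Φ 𝒜) := Set.univ

/-- All `𝒦_i` are reflexive. -/
def classR (Φ : Type u) (𝒜 : Type v) : Set (Kripke.{u, v, w} Φ 𝒜) :=
  {M | ∀ i, ∀ s, M.rel i s s}

/-- All `𝒦_i` are reflexive and transitive. -/
def classRT (Φ : Type u) (𝒜 : Type v) : Set (Kripke.{u, v, w} Φ 𝒜) :=
  {M | ∀ i, (∀ s, M.rel i s s) ∧ (∀ s t r, M.rel i s t → M.rel i t r → M.rel i s r)}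

/-- All `𝒦_i` are reflexive, symmetric and transitive. -/
def classRST (Φ : Type u) (𝒜 : Type v) : Set (Kripke.{u, v, w} Φ 𝒜) :=
  {M | ∀ i, (∀ s, M.rel i s s) ∧ (∀ s t, M.rel i s t → M.rel i t s) ∧
    (∀ s t r, M.rel i s t → M.rel i t r → M.rel i s r)}

/-- All `𝒦_i` are Euclidean, serial and transitive. -/
def classELT (Φ : Type u) (𝒜 : Type v) : Set (Kripke.{u, v, w} Φ 𝒜) :=
  {M | ∀ i, (∀ s t r, M.rel i s t → M.rel i s r → M.rel i t r) ∧ (∀ s, ∃ t, M.rel i s t) ∧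
    (∀ s t r, M.rel i s t → M.rel i t r → M.rel i s r)}

/-! ## Propositional tautologies -/

/-- Formulas of the propositional calculus. -/
inductive PForm : Type
  | var : ℕ → PForm
  | and : PForm → PForm → PForm
  | neg : PForm → PForm

/-- Truth of a propositional formula under a truth assignment. -/
def PForm.eval (a : ℕ → Prop) : PForm → Prop
  | .var n => a n
  | .and p q => p.eval a ∧ q.eval a
  | .neg p => ¬ p.eval a

/-- `p.Tautology`: the formula `p` is true under every truth assignment. -/
def PForm.Tautology (p : PForm) : Prop := ∀ a : ℕ → Prop, p.eval a

/-- Substitution of formulas of the epistemic language for the propositional variables. -/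
def PForm.subst {Φ : Type u} {𝒜 : Type v} {𝒢 : Set (Set 𝒜)} (σ : ℕ → Form Φ 𝒜 𝒢) :
    PForm → Form Φ 𝒜 𝒢
  | .var n => σ n
  | .and p q => .and (p.subst σ) (q.subst σ)
  | .neg p => .neg (p.subst σ)

section Proofs

variable {Φ : Type u} {𝒜 : Type v} {𝒢 : Set (Set 𝒜)}

/-- The abbreviation `φ ⇒ ψ`, that is, `¬(φ ∧ ¬ψ)`. -/
def Form.imp (φ ψ : Form Φ 𝒜 𝒢) : Form Φ 𝒜 𝒢 := .neg (.and φ (.neg ψ))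

/-- The conjunction of a nonempty list of formulas, given by its head and its tail. -/
def Form.conj : Form Φ 𝒜 𝒢 → List (Form Φ 𝒜 𝒢) → Form Φ 𝒜 𝒢
  | φ, [] => φ
  | φ, ψ :: l => .and φ (Form.conj ψ l)

/-! ## Axiom schemes -/

/-- All substitution instances of propositional tautologies. -/
def axProp : Set (Form Φ 𝒜 𝒢) :=
  {χ | ∃ (p : PForm) (σ : ℕ → Form Φ 𝒜 𝒢), p.Tautology ∧ χ = p.subst σ}

/-- `(K_i φ ∧ K_i (φ ⇒ ψ)) ⇒ K_i ψ`. -/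
def axK1 : Set (Form Φ 𝒜 𝒢) :=
  {χ | ∃ (i : 𝒜) (φ ψ : Form Φ 𝒜 𝒢), χ = ((Form.K i φ).and (.K i (φ.imp ψ))).imp (.K i ψ)}

/-- `K_i φ ⇒ φ`. -/
def axK2 : Set (Form Φ 𝒜 𝒢) :=
  {χ | ∃ (i : 𝒜) (φ : Form Φ 𝒜 𝒢), χ = (Form.K i φ).imp φ}

/-- `¬ K_i false`. The language has no constant for falsity; `false` abbreviates a contradiction
`φ ∧ ¬φ`, and all choices of `φ` are admitted. -/
def axK3 : Set (Form Φ 𝒜 𝒢) :=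
  {χ | ∃ (i : 𝒜) (φ : Form Φ 𝒜 𝒢), χ = .neg (.K i (φ.and φ.neg))}

/-- `K_i φ ⇒ K_i K_i φ`. -/
def axK4 : Set (Form Φ 𝒜 𝒢) :=
  {χ | ∃ (i : 𝒜) (φ : Form Φ 𝒜 𝒢), χ = (Form.K i φ).imp (.K i (.K i φ))}

/-- `¬ K_i φ ⇒ K_i ¬ K_i φ`. -/
def axK5 : Set (Form Φ 𝒜 𝒢) :=
  {χ | ∃ (i : 𝒜) (φ : Form Φ 𝒜 𝒢), χ = (Form.K i φ).neg.imp (.K i (Form.K i φ).neg)}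

/-- `E_G φ ⇒ K_i φ` if `i ∈ G`. -/
def axE1 : Set (Form Φ 𝒜 𝒢) :=
  {χ | ∃ (G : 𝒢) (i : 𝒜) (φ : Form Φ 𝒜 𝒢), i ∈ G.1 ∧ χ = (Form.E G φ).imp (.K i φ)}

/-- `(⋀_{i ∈ 𝒜'} K_i φ ∧ ⋀_{G' ∈ 𝒢'} E_{G'} φ) ⇒ E_G φ` if `𝒜' ⊆ 𝒜` and `𝒢' ⊆ 𝒢` are finite and
`G ⊆ 𝒜' ∪ ⋃ 𝒢'`. The finite sets are given by lists `as` and `gs` of their elements. The list of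
conjuncts, here written `ψ :: l`, is nonempty because `G` is. -/
def axE2 : Set (Form Φ 𝒜 𝒢) :=
  {χ | ∃ (G : 𝒢) (φ : Form Φ 𝒜 𝒢) (as : List 𝒜) (gs : List 𝒢)
      (ψ : Form Φ 𝒜 𝒢) (l : List (Form Φ 𝒜 𝒢)),
    (∀ i ∈ G.1, i ∈ as ∨ ∃ G' ∈ gs, i ∈ G'.1) ∧
    as.map (fun i => Form.K i φ) ++ gs.map (fun G' => Form.E G' φ) = ψ :: l ∧
    χ = (Form.conj ψ l).imp (.E G φ)}

/-- `(E_G φ ∧ E_G (φ ⇒ ψ)) ⇒ E_G ψ`. -/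
def axE3 : Set (Form Φ 𝒜 𝒢) :=
  {χ | ∃ (G : 𝒢) (φ ψ : Form Φ 𝒜 𝒢), χ = ((Form.E G φ).and (.E G (φ.imp ψ))).imp (.E G ψ)}

/-- `E_G (E_G φ ⇒ φ)`. -/
def axE4 : Set (Form Φ 𝒜 𝒢) :=
  {χ | ∃ (G : 𝒢) (φ : Form Φ 𝒜 𝒢), χ = .E G ((Form.E G φ).imp φ)}

/-- `¬ φ ⇒ E_G ¬ E_G φ`. -/
def axE6 : Set (Form Φ 𝒜 𝒢) :=
  {χ | ∃ (G : 𝒢) (φ : Form Φ 𝒜 𝒢), χ = φ.neg.imp (.E G (Form.E G φ).neg)}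

/-- `C_G φ ⇒ E_G (φ ∧ C_G φ)`. -/
def axC1 : Set (Form Φ 𝒜 𝒢) :=
  {χ | ∃ (G : 𝒢) (φ : Form Φ 𝒜 𝒢), χ = (Form.C G φ).imp (.E G (φ.and (.C G φ)))}

/-- Provability from a set of axioms by the rules MP, KGen, EGen and RC1. -/
inductive Provable (Ax : Set (Form Φ 𝒜 𝒢)) : Form Φ 𝒜 𝒢 → Prop
  | ax {φ : Form Φ 𝒜 𝒢} : φ ∈ Ax → Provable Ax φ
  | mp {φ ψ : Form Φ 𝒜 𝒢} : Provable Ax φ → Provable Ax (φ.imp ψ) → Provable Ax ψ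
  | kGen {φ : Form Φ 𝒜 𝒢} (i : 𝒜) : Provable Ax φ → Provable Ax (.K i φ)
  | eGen {φ : Form Φ 𝒜 𝒢} (G : 𝒢) : Provable Ax φ → Provable Ax (.E G φ)
  | rc1 {φ ψ : Form Φ 𝒜 𝒢} (G : 𝒢) :
      Provable Ax (φ.imp (.E G (ψ.and φ))) → Provable Ax (φ.imp (.C G ψ))

end Proofs

section Systems

variable (Φ : Type u) (𝒜 : Type v) (𝒢 : Set (Set 𝒜))

/-! ## The axioms of the five systems (the rules are those of `Provable`) -/

/-- The axioms of `K_𝒢^C`. -/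
def sysK : Set (Form Φ 𝒜 𝒢) := axProp ∪ axK1 ∪ axE1 ∪ axE2 ∪ axE3 ∪ axC1

/-- The axioms of `T_𝒢^C`. -/
def sysT : Set (Form Φ 𝒜 𝒢) := sysK Φ 𝒜 𝒢 ∪ axK2

/-- The axioms of `S4_𝒢^C`. -/
def sysS4 : Set (Form Φ 𝒜 𝒢) := sysK Φ 𝒜 𝒢 ∪ axK2 ∪ axK4

/-- The axioms of `S5_𝒢^C`. -/
def sysS5 : Set (Form Φ 𝒜 𝒢) := sysK Φ 𝒜 𝒢 ∪ axK2 ∪ axK4 ∪ axK5 ∪ axE6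

/-- The axioms of `KD45_𝒢^C`. -/
def sysKD45 : Set (Form Φ 𝒜 𝒢) := sysK Φ 𝒜 𝒢 ∪ axK3 ∪ axK4 ∪ axK5 ∪ axE4

/-- Every formula provable from `Ax` is valid in `𝓜`. -/
def Sound {Φ : Type u} {𝒜 : Type v} {𝒢 : Set (Set 𝒜)} (Ax : Set (Form Φ 𝒜 𝒢))
    (𝓜 : Set (Kripke.{u, v, w} Φ 𝒜)) : Prop :=
  ∀ φ : Form Φ 𝒜 𝒢, Provable Ax φ → Valid 𝓜 φ

/-- Every formula valid in `𝓜` is provable from `Ax`. -/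
def Complete {Φ : Type u} {𝒜 : Type v} {𝒢 : Set (Set 𝒜)} (Ax : Set (Form Φ 𝒜 𝒢))
    (𝓜 : Set (Kripke.{u, v, w} Φ 𝒜)) : Prop :=
  ∀ φ : Form Φ 𝒜 𝒢, Valid 𝓜 φ → Provable Ax φ

end Systems

end CK

/-!
# Completeness of epistemic logic with common knowledge for infinitely many agents

Soundness is a direct check. For completeness, a formula `φ` that is not provable is left out of
some maximal consistent set, and a finite structure is built from the maximal consistent sets,
identified when they agree on the subformulas `χ` of `φ` and on the formulas `K_i χ` for finitely
many agents `i ∈ A` (`exists_filtration`).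

The difficulty is `E_G` for an infinite group `G`: the canonical relations of the agents need not
have the canonical relation of `E_G` as their union. Only finitely many groups occur in `φ`, and
an agent outside `A` matters only through its type, the set of these groups that contain it. A type
`τ` has the canonical relation that is the intersection of the relations of the `E_G`, `G ∈ τ`.
By E2 the canonical relation of `E_G` is covered by those of the agents of `G` in `A` and of
the types of the other agents of `G` (`Mcs.AccE.exists_agent`).

The axioms make the relation of a single agent in `A` satisfy the frame condition, but give less
for a type: it is reflexive (K2), symmetric (E6), or serial with reflexive targets (K3, E4), but
transitivity is lost. The set `A` is chosen to contain all agents whose type is shared by finitely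
many agents only, so that each other type belongs to infinitely many agents. These divide the type
relation among them: a reflexive relation is a union of preorders with one nontrivial pair, a
reflexive symmetric relation is a union of equivalence relations with one nontrivial pair, and a
serial relation with reflexive targets is a union of graphs of idempotent functions, once states are
duplicated by finitely many labels (`Realizes`). The truth lemma `Filtration.IsAdequate.sat_iff`
uses only the union; its clause for `C_G` applies RC1 to the formula that defines the set
of classes over which `C_G ψ` is true somewhere.
-/

namespace CK

section Completeness

variable {Φ : Type u} {𝒜 : Type v} {𝒢 : Set (Set 𝒜)}

/-! ### Maximal consistent sets -/

/-- Maximal consistent sets with respect to the axioms `Ax`, presented as the sets of formulas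
that are true under a Boolean valuation which makes every provable formula true. -/
structure Mcs (Ax : Set (Form Φ 𝒜 𝒢)) where
  carrier : Set (Form Φ 𝒜 𝒢)
  and_mem' : ∀ φ ψ, φ.and ψ ∈ carrier ↔ φ ∈ carrier ∧ ψ ∈ carrier
  neg_mem' : ∀ φ, φ.neg ∈ carrier ↔ φ ∉ carrier
  provable_mem' : ∀ φ, Provable Ax φ → φ ∈ carrier

/-- Derivability from the hypotheses `Γ`: only modus ponens may be applied to them. -/
inductive Der (Ax Γ : Set (Form Φ 𝒜 𝒢)) : Form Φ 𝒜 𝒢 → Prop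
  | thm {φ} : Provable Ax φ → Der Ax Γ φ
  | hyp {φ} : φ ∈ Γ → Der Ax Γ φ
  | mp {φ ψ} : Der Ax Γ φ → Der Ax Γ (φ.imp ψ) → Der Ax Γ ψ

variable {Ax : Set (Form Φ 𝒜 𝒢)}

instance : Membership (Form Φ 𝒜 𝒢) (Mcs Ax) := ⟨fun s φ => φ ∈ s.carrier⟩

namespace Mcs

variable {s : Mcs Ax} {φ ψ : Form Φ 𝒜 𝒢}

theorem and_mem : φ.and ψ ∈ s ↔ φ ∈ s ∧ ψ ∈ s := s.and_mem' _ _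

theorem neg_mem : φ.neg ∈ s ↔ φ ∉ s := s.neg_mem' _

theorem provable_mem (s : Mcs Ax) (h : Provable Ax φ) : φ ∈ s := s.provable_mem' _ h

theorem imp_mem : φ.imp ψ ∈ s ↔ (φ ∈ s → ψ ∈ s) := by
  simp [Form.imp, neg_mem, and_mem]

theorem conj_mem {l : List (Form Φ 𝒜 𝒢)} :
    Form.conj φ l ∈ s ↔ ∀ χ ∈ φ :: l, χ ∈ s := by
  induction l generalizing φ with
  | nil => simp [Form.conj]
  | cons ψ l ih => rw [Form.conj, and_mem, ih]; simp

end Mcs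

/-- The conditional of the propositional calculus. -/
def PForm.imp (p q : PForm) : PForm := .neg (.and p (.neg q))

theorem PForm.eval_imp (a : ℕ → Prop) (p q : PForm) :
    (p.imp q).eval a ↔ (p.eval a → q.eval a) := by
  simp [PForm.imp, PForm.eval]

/-- The substitution of `α`, `β`, `γ` for the first three propositional variables. -/
def substThree (α β γ : Form Φ 𝒜 𝒢) : ℕ → Form Φ 𝒜 𝒢
  | 0 => α
  | 1 => β
  | _ => γ

theorem provable_subst (hK : sysK Φ 𝒜 𝒢 ⊆ Ax) (p : PForm) (hp : p.Tautology)
    (α β γ : Form Φ 𝒜 𝒢) : Provable Ax (p.subst (substThree α β γ)) :=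
  .ax (hK (by
    simp only [sysK, Set.mem_union]
    exact .inl (.inl (.inl (.inl (.inl ⟨p, _, hp, rfl⟩))))))

section Tautologies

variable (hK : sysK Φ 𝒜 𝒢 ⊆ Ax) (α β γ : Form Φ 𝒜 𝒢)
include hK

theorem provable_const : Provable Ax (α.imp (β.imp α)) :=
  provable_subst hK (.imp (.var 0) (.imp (.var 1) (.var 0)))
    (fun a => by simp only [PForm.eval_imp]; tauto) α β α

theorem provable_distrib :
    Provable Ax ((α.imp (β.imp γ)).imp ((α.imp β).imp (α.imp γ))) :=
  provable_subst hK (.imp (.imp (.var 0) (.imp (.var 1) (.var 2)))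
    (.imp (.imp (.var 0) (.var 1)) (.imp (.var 0) (.var 2))))
    (fun a => by simp only [PForm.eval_imp]; tauto) α β γ

theorem provable_refl : Provable Ax (α.imp α) :=
  provable_subst hK (.imp (.var 0) (.var 0)) (fun a => by simp [PForm.eval_imp]) α α α

theorem provable_cases : Provable Ax ((α.imp β).imp ((α.neg.imp β).imp β)) :=
  provable_subst hK (.imp (.imp (.var 0) (.var 1)) (.imp (.imp (.neg (.var 0)) (.var 1)) (.var 1)))
    (fun a => by simp only [PForm.eval_imp, PForm.eval]; tauto) α β β

theorem provable_explosion : Provable Ax (α.imp (α.neg.imp β)) :=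
  provable_subst hK (.imp (.var 0) (.imp (.neg (.var 0)) (.var 1)))
    (fun a => by simp only [PForm.eval_imp, PForm.eval]; tauto) α β β

theorem provable_and_intro : Provable Ax (α.imp (β.imp (α.and β))) :=
  provable_subst hK (.imp (.var 0) (.imp (.var 1) (.and (.var 0) (.var 1))))
    (fun a => by simp only [PForm.eval_imp, PForm.eval]; tauto) α β β

theorem provable_and_left : Provable Ax ((α.and β).imp α) :=
  provable_subst hK (.imp (.and (.var 0) (.var 1)) (.var 0))
    (fun a => by simp only [PForm.eval_imp, PForm.eval]; tauto) α β β

theorem provable_and_right : Provable Ax ((α.and β).imp β) :=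
  provable_subst hK (.imp (.and (.var 0) (.var 1)) (.var 1))
    (fun a => by simp only [PForm.eval_imp, PForm.eval]; tauto) α β β

end Tautologies

theorem Der.deduction (hK : sysK Φ 𝒜 𝒢 ⊆ Ax) {Γ : Set (Form Φ 𝒜 𝒢)} {α β : Form Φ 𝒜 𝒢}
    (h : Der Ax (insert α Γ) β) : Der Ax Γ (α.imp β) := by
  induction h with
  | thm h => exact .thm (.mp h (provable_const hK _ _))
  | hyp h =>
    rcases h with rfl | h
    · exact .thm (provable_refl hK _)
    · exact .mp (.hyp h) (.thm (provable_const hK _ _))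
  | mp _ _ ih₁ ih₂ => exact .mp ih₁ (.mp ih₂ (.thm (provable_distrib hK _ _ _)))

/-- Derivations use finitely many hypotheses, here in the form needed for Zorn's lemma. -/
theorem Der.exists_of_sUnion {c : Set (Set (Form Φ 𝒜 𝒢))} (hc : IsChain (· ⊆ ·) c)
    (hne : c.Nonempty) {φ : Form Φ 𝒜 𝒢} (h : Der Ax (⋃₀ c) φ) : ∃ Γ ∈ c, Der Ax Γ φ := by
  have mono : ∀ {Γ Δ : Set (Form Φ 𝒜 𝒢)} {ψ}, Γ ⊆ Δ → Der Ax Γ ψ → Der Ax Δ ψ := by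
    intro Γ Δ ψ hs h
    induction h with
    | thm h => exact .thm h
    | hyp h => exact .hyp (hs h)
    | mp _ _ ih₁ ih₂ => exact .mp ih₁ ih₂
  induction h with
  | thm h => exact hne.imp fun Γ hΓ => ⟨hΓ, .thm h⟩
  | hyp h => obtain ⟨Γ, hΓ, h⟩ := h; exact ⟨Γ, hΓ, .hyp h⟩
  | mp _ _ ih₁ ih₂ =>
    obtain ⟨Γ, hΓ, h₁⟩ := ih₁
    obtain ⟨Δ, hΔ, h₂⟩ := ih₂
    rcases hc.total hΓ hΔ with h | h
    · exact ⟨Δ, hΔ, .mp (mono h h₁) h₂⟩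
    · exact ⟨Γ, hΓ, .mp h₁ (mono h h₂)⟩

/-- Lindenbaum's lemma. -/
theorem exists_mcs (hK : sysK Φ 𝒜 𝒢 ⊆ Ax) {Γ : Set (Form Φ 𝒜 𝒢)} {θ : Form Φ 𝒜 𝒢}
    (h : ¬ Der Ax Γ θ) : ∃ s : Mcs Ax, (∀ φ ∈ Γ, φ ∈ s) ∧ θ ∉ s := by
  obtain ⟨Δ, hΓΔ, hΔ⟩ := zorn_subset_nonempty {Δ | ¬ Der Ax Δ θ}
    (fun c hc hchain hne => ⟨⋃₀ c, fun hd => by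
      obtain ⟨Δ, hΔ, hd⟩ := hd.exists_of_sUnion hchain hne
      exact hc hΔ hd, fun _ => Set.subset_sUnion_of_mem⟩) Γ h
  have hcons : ¬ Der Ax Δ θ := hΔ.prop
  have hmax : ∀ α, α ∉ Δ → Der Ax Δ (α.imp θ) := fun α hα => by
    by_contra hd
    exact hα (hΔ.le_of_ge (y := insert α Δ) (fun hi => hd (hi.deduction hK))
      (Set.subset_insert _ _) (Set.mem_insert _ _))
  have hmem : ∀ α, Der Ax Δ α → α ∈ Δ := fun α hα => by
    by_contra hn
    exact hcons (.mp hα (hmax α hn))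
  refine ⟨⟨Δ, fun φ ψ => ⟨fun h => ⟨?_, ?_⟩, fun h => ?_⟩, fun φ => ⟨fun h h' => ?_, fun h => ?_⟩,
    fun φ h => hmem _ (.thm h)⟩, fun φ h => hΓΔ h, fun h => hcons (.hyp h)⟩
  · exact hmem _ (.mp (.hyp h) (.thm (provable_and_left hK _ _)))
  · exact hmem _ (.mp (.hyp h) (.thm (provable_and_right hK _ _)))
  · exact hmem _ (.mp (.hyp h.2) (.mp (.hyp h.1) (.thm (provable_and_intro hK _ _))))
  · exact hcons (.mp (.hyp h) (.mp (.hyp h') (.thm (provable_explosion hK _ _))))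
  · by_contra hn
    exact hcons (.mp (hmax _ hn) (.mp (hmax _ h) (.thm (provable_cases hK _ _))))

theorem provable_of_forall_mcs (hK : sysK Φ 𝒜 𝒢 ⊆ Ax) {θ : Form Φ 𝒜 𝒢}
    (h : ∀ s : Mcs Ax, θ ∈ s) : Provable Ax θ := by
  by_contra hn
  have hd : ¬ Der Ax ∅ θ := by
    intro hd
    apply hn
    clear h hn
    induction hd with
    | thm h => exact h
    | hyp h => exact h.elim
    | mp _ _ ih₁ ih₂ => exact .mp ih₁ ih₂
  obtain ⟨s, -, hs⟩ := exists_mcs hK hd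
  exact hs (h s)

/-! ### Canonical accessibility -/

/-- The canonical accessibility relation of the agent `i`. -/
def Mcs.AccK (i : 𝒜) (s t : Mcs Ax) : Prop := ∀ χ, Form.K i χ ∈ s → χ ∈ t

/-- The canonical accessibility relation of the operators `E_G` with `G ∈ τ`, taken together. -/
def Mcs.AccE (τ : Set 𝒢) (s t : Mcs Ax) : Prop := ∀ G ∈ τ, ∀ χ, Form.E G χ ∈ s → χ ∈ t

section Canonical

variable (hK : sysK Φ 𝒜 𝒢 ⊆ Ax)
include hK

theorem Mcs.exists_accK {s : Mcs Ax} {i : 𝒜} {θ : Form Φ 𝒜 𝒢} (h : Form.K i θ ∉ s) :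
    ∃ t, s.AccK i t ∧ θ ∉ t := by
  refine exists_mcs hK (Γ := {χ | Form.K i χ ∈ s}) fun hd => h ?_
  clear h
  induction hd with
  | thm h => exact s.provable_mem (.kGen i h)
  | hyp h => exact h
  | @mp α β _ _ ih₁ ih₂ =>
    have : ((Form.K i α).and (.K i (α.imp β))).imp (.K i β) ∈ s := by
      refine s.provable_mem (.ax (hK ?_))
      simp only [sysK, Set.mem_union]
      exact .inl (.inl (.inl (.inl (.inr ⟨_, _, _, rfl⟩))))
    exact imp_mem.1 this (and_mem.2 ⟨ih₁, ih₂⟩)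

theorem Mcs.exists_accE {s : Mcs Ax} {G : 𝒢} {θ : Form Φ 𝒜 𝒢} (h : Form.E G θ ∉ s) :
    ∃ t, s.AccE {G} t ∧ θ ∉ t := by
  have : ∃ t : Mcs Ax, (∀ φ ∈ {χ | Form.E G χ ∈ s}, φ ∈ t) ∧ θ ∉ t := by
    refine exists_mcs hK fun hd => h ?_
    clear h
    induction hd with
    | thm h => exact s.provable_mem (.eGen G h)
    | hyp h => exact h
    | @mp α β _ _ ih₁ ih₂ =>
      have : ((Form.E G α).and (.E G (α.imp β))).imp (.E G β) ∈ s := by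
        refine s.provable_mem (.ax (hK ?_))
        simp only [sysK, Set.mem_union]
        exact .inl (.inr ⟨_, _, _, rfl⟩)
      exact imp_mem.1 this (and_mem.2 ⟨ih₁, ih₂⟩)
  simpa [AccE] using this

theorem Mcs.K_mono {s : Mcs Ax} {i : 𝒜} {φ ψ : Form Φ 𝒜 𝒢} (h : ∀ t : Mcs Ax, φ ∈ t → ψ ∈ t)
    (hs : Form.K i φ ∈ s) : Form.K i ψ ∈ s := by
  by_contra hn
  obtain ⟨t, ht, hψ⟩ := exists_accK hK hn
  exact hψ (h t (ht _ hs))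

theorem Mcs.E_mono {s : Mcs Ax} {G : 𝒢} {φ ψ : Form Φ 𝒜 𝒢} (h : ∀ t : Mcs Ax, φ ∈ t → ψ ∈ t)
    (hs : Form.E G φ ∈ s) : Form.E G ψ ∈ s := by
  by_contra hn
  obtain ⟨t, ht, hψ⟩ := exists_accE hK hn
  exact hψ (h t (ht G rfl _ hs))

theorem Mcs.K_mem_of_E_mem {s : Mcs Ax} {G : 𝒢} {i : 𝒜} (hi : i ∈ G.1) {φ : Form Φ 𝒜 𝒢}
    (h : Form.E G φ ∈ s) : Form.K i φ ∈ s := by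
  refine imp_mem.1 (s.provable_mem (.ax (hK ?_))) h
  simp only [sysK, Set.mem_union]
  exact .inl (.inl (.inl (.inr ⟨G, i, φ, hi, rfl⟩)))

theorem Mcs.E_and_C_mem {s : Mcs Ax} {G : 𝒢} {φ : Form Φ 𝒜 𝒢} (h : Form.C G φ ∈ s) :
    Form.E G (φ.and (.C G φ)) ∈ s := by
  refine imp_mem.1 (s.provable_mem (.ax (hK ?_))) h
  simp only [sysK, Set.mem_union]
  exact .inr ⟨G, φ, rfl⟩

theorem Mcs.E_mem_of_cover {s : Mcs Ax} {G : 𝒢} (hG : G.1.Nonempty) {φ : Form Φ 𝒜 𝒢}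
    {A : Set 𝒜} {𝒢' : Set 𝒢} (hA : A.Finite) (h𝒢' : 𝒢'.Finite)
    (hAs : ∀ i ∈ A, Form.K i φ ∈ s) (h𝒢s : ∀ G' ∈ 𝒢', Form.E G' φ ∈ s)
    (hcov : ∀ i ∈ G.1, i ∈ A ∨ ∃ G' ∈ 𝒢', i ∈ G'.1) : Form.E G φ ∈ s := by
  set as := hA.toFinset.toList with has
  set gs := h𝒢'.toFinset.toList with hgs
  have has' : ∀ i, i ∈ as ↔ i ∈ A := by simp [has]
  have hgs' : ∀ G', G' ∈ gs ↔ G' ∈ 𝒢' := by simp only [hgs]; simp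
  have hmem : ∀ χ ∈ as.map (fun i => Form.K i φ) ++ gs.map (fun G' => Form.E G' φ), χ ∈ s := by
    intro χ hχ
    rw [List.mem_append, List.mem_map, List.mem_map] at hχ
    rcases hχ with ⟨i, hi, rfl⟩ | ⟨G', hG', rfl⟩
    · exact hAs _ ((has' i).1 hi)
    · exact h𝒢s _ ((hgs' G').1 hG')
  rcases hl : as.map (fun i => Form.K i φ) ++ gs.map (fun G' => Form.E G' φ) with _ | ⟨ψ, l⟩
  · obtain ⟨i, hi⟩ := hG
    rw [List.append_eq_nil_iff, List.map_eq_nil_iff, List.map_eq_nil_iff] at hl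
    rcases hcov i hi with h | ⟨G', h, -⟩
    · rw [← has', hl.1] at h; simp at h
    · rw [← hgs', hl.2] at h; simp at h
  · rw [hl] at hmem
    refine imp_mem.1 (s.provable_mem (.ax (hK ?_))) (conj_mem.2 hmem)
    simp only [sysK, Set.mem_union]
    refine .inl (.inl (.inr ⟨G, φ, as, gs, ψ, l, fun i hi => ?_, hl, rfl⟩))
    exact (hcov i hi).imp (has' i).2 fun ⟨G', h, h'⟩ => ⟨G', (hgs' G').2 h, h'⟩

end Canonical

/-- The disjunction of a finite family of formulas. The formula `φ₀` is needed only for the empty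
disjunction, as the language has no constants. -/
theorem Mcs.exists_disj (φ₀ : Form Φ 𝒜 𝒢) {ι : Type*} (f : ι → Form Φ 𝒜 𝒢) {T : Set ι}
    (hT : T.Finite) : ∃ δ : Form Φ 𝒜 𝒢, ∀ s : Mcs Ax, δ ∈ s ↔ ∃ i ∈ T, f i ∈ s := by
  induction T, hT using Set.Finite.induction_on with
  | empty => exact ⟨φ₀.and φ₀.neg, by simp [and_mem, neg_mem]⟩
  | @insert a T _ _ ih =>
    obtain ⟨δ, hδ⟩ := ih
    refine ⟨((f a).neg.and δ.neg).neg, fun s => ?_⟩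
    simp only [and_mem, neg_mem, hδ, Set.exists_mem_insert]
    rw [not_and_or, not_not, not_not]

/-- The groups in `𝒢₀` to which the agent `i` belongs. -/
def groupType (𝒢₀ : Set 𝒢) (i : 𝒜) : Set 𝒢 := {G ∈ 𝒢₀ | i ∈ G.1}

/-- Canonical accessibility for `E_G` is covered by canonical accessibility for finitely many named
agents of `G` and for the types of the other agents of `G`. Otherwise each of these finitely many
relations is refuted by a formula that is boxed in `s` and missing in `u`; the disjunction `Y` of
these formulas is missing in `u` as well, but it is boxed in `s` by operators that cover `G`, so
that E2 puts `E_G Y` into `s`. -/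
theorem Mcs.AccE.exists_agent (hK : sysK Φ 𝒜 𝒢 ⊆ Ax) {A : Set 𝒜} {𝒢₀ : Set 𝒢} (hA : A.Finite)
    (h𝒢₀ : 𝒢₀.Finite) {G : 𝒢} (hG : G.1.Nonempty) {s u : Mcs Ax} (h : s.AccE {G} u) :
    ∃ i ∈ G.1, (i ∈ A ∧ s.AccK i u) ∨ (i ∉ A ∧ s.AccE (groupType 𝒢₀ i) u) := by
  by_contra! hn
  have h₁ : ∀ i, i ∈ G.1 ∧ i ∈ A → ∃ y ∉ u, Form.K i y ∈ s := fun i hi => by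
    have := (hn i hi.1).1 hi.2
    simp only [AccK, not_forall] at this
    obtain ⟨y, hy, hu⟩ := this
    exact ⟨y, hu, hy⟩
  have h₂ : ∀ τ, (∃ i ∈ G.1, i ∉ A ∧ groupType 𝒢₀ i = τ) →
      ∃ y ∉ u, ∃ G' ∈ τ, Form.E G' y ∈ s := by
    rintro τ ⟨i, hi, hiA, rfl⟩
    have := (hn i hi).2 hiA
    simp only [AccE, not_forall] at this
    obtain ⟨G', hG', y, hy, hu⟩ := this
    exact ⟨y, hu, G', hG', hy⟩
  obtain ⟨i₀, hi₀⟩ := hG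
  have hne : Nonempty (Form Φ 𝒜 𝒢) := by
    by_cases hi : i₀ ∈ A
    · exact ⟨(h₁ i₀ ⟨hi₀, hi⟩).choose⟩
    · exact ⟨(h₂ _ ⟨i₀, hi₀, hi, rfl⟩).choose⟩
  obtain ⟨φ₀⟩ := id hne
  choose! f hfu hfs using h₁
  choose! g hgu hgs using h₂
  have hT : ({τ | ∃ i ∈ G.1, i ∉ A ∧ groupType 𝒢₀ i = τ} : Set (Set 𝒢)).Finite :=
    h𝒢₀.finite_subsets.subset (by rintro τ ⟨i, -, -, rfl⟩; exact Set.sep_subset _ _)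
  obtain ⟨Y, hdisj⟩ := exists_disj (Ax := Ax) φ₀ id
    (((hA.subset (Set.inter_subset_right (s := G.1))).image f).union (hT.image g))
  have hY : Y ∉ u := fun hYu => by
    obtain ⟨y, ⟨i, hi, rfl⟩ | ⟨τ, hτ, rfl⟩, hy⟩ := (hdisj u).1 hYu
    · exact hfu i hi hy
    · exact hgu τ hτ hy
  have hb : ∀ y, _ → ∀ t : Mcs Ax, y ∈ t → Y ∈ t := fun y hy t ht => (hdisj t).2 ⟨y, hy, ht⟩
  refine hY (h G rfl Y (E_mem_of_cover hK ⟨i₀, hi₀⟩ (A := {i | i ∈ G.1 ∧ i ∈ A})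
    (𝒢' := {G' ∈ 𝒢₀ | Form.E G' Y ∈ s}) (hA.subset fun i hi => hi.2)
    (h𝒢₀.subset (Set.sep_subset _ _)) (fun i hi => ?_) (fun G' hG' => hG'.2) fun i hi => ?_))
  · exact K_mono hK (hb _ (.inl ⟨i, hi, rfl⟩)) (hfs i hi)
  · by_cases hiA : i ∈ A
    · exact .inl ⟨hi, hiA⟩
    · have hτ : ∃ j ∈ G.1, j ∉ A ∧ groupType 𝒢₀ j = groupType 𝒢₀ i := ⟨i, hi, hiA, rfl⟩
      obtain ⟨G', hG', hE⟩ := hgs _ hτ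
      exact .inr ⟨G', ⟨hG'.1, E_mono hK (hb _ (.inr ⟨_, hτ, rfl⟩)) hE⟩, hG'.2⟩

/-! ### Filtrations -/

/-- `Cl` is closed under immediate subformulas, and `A`, `𝒢₀` contain the agents and the groups
whose operators occur in it. -/
structure IsFragment (Cl : Set (Form Φ 𝒜 𝒢)) (A : Set 𝒜) (𝒢₀ : Set 𝒢) : Prop where
  and : ∀ φ ψ, Form.and φ ψ ∈ Cl → φ ∈ Cl ∧ ψ ∈ Cl
  neg : ∀ φ, Form.neg φ ∈ Cl → φ ∈ Cl
  K : ∀ i φ, Form.K i φ ∈ Cl → φ ∈ Cl ∧ i ∈ A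
  E : ∀ G φ, Form.E G φ ∈ Cl → φ ∈ Cl ∧ G ∈ 𝒢₀
  C : ∀ G φ, Form.C G φ ∈ Cl → φ ∈ Cl ∧ G ∈ 𝒢₀

/-- The subformulas of `φ`, with their agents and groups, form a finite fragment. -/
theorem exists_fragment (φ : Form Φ 𝒜 𝒢) : ∃ (Cl : Set (Form Φ 𝒜 𝒢)) (A : Set 𝒜) (𝒢₀ : Set 𝒢),
    Cl.Finite ∧ A.Finite ∧ 𝒢₀.Finite ∧ φ ∈ Cl ∧ IsFragment Cl A 𝒢₀ := by
  induction φ with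
  | atom p =>
    exact ⟨{.atom p}, ∅, ∅, Set.finite_singleton _, Set.finite_empty, Set.finite_empty, rfl,
      by constructor <;> simp⟩
  | and φ ψ ih₁ ih₂ =>
    obtain ⟨Cl, A, 𝒢₀, hCl, hA, h𝒢, hφ, hF⟩ := ih₁
    obtain ⟨Cl', A', 𝒢₀', hCl', hA', h𝒢', hψ, hF'⟩ := ih₂
    refine ⟨insert (φ.and ψ) (Cl ∪ Cl'), A ∪ A', 𝒢₀ ∪ 𝒢₀', (hCl.union hCl').insert _,
      hA.union hA', h𝒢.union h𝒢', .inl rfl, ?_⟩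
    constructor <;> simp only [Set.mem_insert_iff, Set.mem_union]
    · rintro α β (h | h | h)
      · cases h; tauto
      · have := hF.and _ _ h; tauto
      · have := hF'.and _ _ h; tauto
    · rintro α (h | h | h)
      · cases h
      · have := hF.neg _ h; tauto
      · have := hF'.neg _ h; tauto
    · rintro i α (h | h | h)
      · cases h
      · have := hF.K _ _ h; tauto
      · have := hF'.K _ _ h; tauto
    · rintro i α (h | h | h)
      · cases h
      · have := hF.E _ _ h; tauto
      · have := hF'.E _ _ h; tauto
    · rintro i α (h | h | h)
      · cases h
      · have := hF.C _ _ h; tauto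
      · have := hF'.C _ _ h; tauto
  | neg φ ih =>
    obtain ⟨Cl, A, 𝒢₀, hCl, hA, h𝒢, hφ, hF⟩ := ih
    refine ⟨insert φ.neg Cl, A, 𝒢₀, hCl.insert _, hA, h𝒢, .inl rfl, ?_⟩
    have := hF.and; have := hF.neg; have := hF.K; have := hF.E; have := hF.C
    constructor <;> simp only [Set.mem_insert_iff] <;> grind
  | K i φ ih =>
    obtain ⟨Cl, A, 𝒢₀, hCl, hA, h𝒢, hφ, hF⟩ := ih
    refine ⟨insert (.K i φ) Cl, insert i A, 𝒢₀, hCl.insert _, hA.insert _, h𝒢, .inl rfl, ?_⟩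
    have := hF.and; have := hF.neg; have := hF.K; have := hF.E; have := hF.C
    constructor <;> simp only [Set.mem_insert_iff] <;> grind
  | E G φ ih =>
    obtain ⟨Cl, A, 𝒢₀, hCl, hA, h𝒢, hφ, hF⟩ := ih
    refine ⟨insert (.E G φ) Cl, A, insert G 𝒢₀, hCl.insert _, hA, h𝒢.insert _, .inl rfl, ?_⟩
    have := hF.and; have := hF.neg; have := hF.K; have := hF.E; have := hF.C
    constructor <;> simp only [Set.mem_insert_iff] <;> grind
  | C G φ ih =>
    obtain ⟨Cl, A, 𝒢₀, hCl, hA, h𝒢, hφ, hF⟩ := ih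
    refine ⟨insert (.C G φ) Cl, A, insert G 𝒢₀, hCl.insert _, hA, h𝒢.insert _, .inl rfl, ?_⟩
    have := hF.and; have := hF.neg; have := hF.K; have := hF.E; have := hF.C
    constructor <;> simp only [Set.mem_insert_iff] <;> grind

/-- A finite quotient of the maximal consistent sets that decides all `χ` and `K_i χ` with
`χ ∈ Cl` and `i ∈ A`, and all of whose sets of classes are defined by formulas. The classes live
in an arbitrary universe, as the states of a Kripke structure do. -/
structure Filtration (Ax Cl : Set (Form Φ 𝒜 𝒢)) (A : Set 𝒜) where
  S : Type w
  finite : Finite S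
  cls : Mcs Ax → S
  surj : Function.Surjective cls
  mem_iff : ∀ {s t}, cls s = cls t → ∀ χ ∈ Cl, (χ ∈ s ↔ χ ∈ t)
  K_mem_iff : ∀ {s t}, cls s = cls t → ∀ i ∈ A, ∀ χ ∈ Cl, (Form.K i χ ∈ s ↔ Form.K i χ ∈ t)
  definable : ∀ D : Set S, ∃ δ : Form Φ 𝒜 𝒢, ∀ s, δ ∈ s ↔ cls s ∈ D

theorem exists_filtration (φ₀ : Form Φ 𝒜 𝒢) {Cl : Set (Form Φ 𝒜 𝒢)} {A : Set 𝒜}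
    (hCl : Cl.Finite) (hA : A.Finite) : Nonempty (Filtration.{u, v, w} Ax Cl A) := by
  set D : Set (Form Φ 𝒜 𝒢) := Cl ∪ Set.image2 Form.K A Cl
  have hD : D.Finite := hCl.union (hA.image2 _ hCl)
  have : Finite D := hD
  let tr : Mcs Ax → Set D := fun s => {χ | χ.1 ∈ s}
  obtain ⟨n, ⟨e⟩⟩ := Finite.exists_equiv_fin (Set.range tr)
  let cls : Mcs Ax → ULift.{w} (Fin n) := fun s => ⟨e ⟨tr s, Set.mem_range_self s⟩⟩
  have hcls : ∀ {s t}, cls s = cls t ↔ ∀ χ ∈ D, (χ ∈ s ↔ χ ∈ t) := fun {s t} => by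
    simp only [cls, ULift.up_inj, e.apply_eq_iff_eq]
    rw [Subtype.mk_eq_mk, Set.ext_iff, Subtype.forall]
    rfl
  have hsurj : Function.Surjective cls := by
    rintro ⟨k⟩
    obtain ⟨⟨_, s, rfl⟩, hx⟩ := e.surjective k
    exact ⟨s, congrArg ULift.up hx⟩
  refine ⟨⟨ULift.{w} (Fin n), inferInstance, cls, hsurj, fun h χ hχ => hcls.1 h χ (.inl hχ),
    fun h i hi χ hχ => hcls.1 h _ (.inr ⟨i, hi, χ, hχ, rfl⟩), fun X => ?_⟩⟩
  -- The class of `s` is defined by the negation of the disjunction of those literals over `D` that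
  -- are false in `s`.
  have hchar : ∀ a, ∃ δ : Form Φ 𝒜 𝒢, ∀ t : Mcs Ax, δ ∈ t ↔ cls t = a := by
    intro a
    obtain ⟨s, rfl⟩ := hsurj a
    classical
    obtain ⟨δ, hδ⟩ := Mcs.exists_disj (Ax := Ax) φ₀ (fun χ => if χ ∈ s then χ.neg else χ) hD
    refine ⟨δ.neg, fun t => ?_⟩
    simp only [Mcs.neg_mem, hδ, hcls, not_exists, not_and]
    refine forall₂_congr fun χ _ => ?_
    by_cases h : χ ∈ s <;> simp [h, Mcs.neg_mem]
  choose f hf using hchar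
  obtain ⟨δ, hδ⟩ := Mcs.exists_disj (Ax := Ax) φ₀ f X.toFinite
  exact ⟨δ, fun s => by simp [hδ, hf]⟩

namespace Filtration

variable {Cl : Set (Form Φ 𝒜 𝒢)} {A : Set 𝒜} (F : Filtration.{u, v, w} Ax Cl A)

attribute [instance] Filtration.finite

/-- A maximal consistent set in the class `a`. -/
noncomputable def rep (a : F.S) : Mcs Ax := Function.surjInv F.surj a

theorem cls_rep (a : F.S) : F.cls (F.rep a) = a := Function.surjInv_eq F.surj a

theorem mem_rep {s : Mcs Ax} {χ : Form Φ 𝒜 𝒢} (hχ : χ ∈ Cl) : χ ∈ F.rep (F.cls s) ↔ χ ∈ s :=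
  F.mem_iff (F.cls_rep _) χ hχ

theorem K_mem_rep {s : Mcs Ax} {i : 𝒜} {χ : Form Φ 𝒜 𝒢} (hi : i ∈ A) (hχ : χ ∈ Cl) :
    Form.K i χ ∈ F.rep (F.cls s) ↔ Form.K i χ ∈ s :=
  F.K_mem_iff (F.cls_rep _) i hi χ hχ

/-- Accessibility between classes for an agent in `A`. Under K4 the formulas `K_i χ` persist along
it, and under K5 so do their negations. -/
def relK (i : 𝒜) (a b : F.S) : Prop :=
  ∀ χ ∈ Cl, (Form.K i χ ∈ F.rep a → χ ∈ F.rep b) ∧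
    (axK4 ⊆ Ax → Form.K i χ ∈ F.rep a → Form.K i χ ∈ F.rep b) ∧
    (axK5 ⊆ Ax → Form.K i χ ∈ F.rep b → Form.K i χ ∈ F.rep a)

/-- Accessibility between classes for the groups in `τ`: the image of canonical accessibility. -/
def relE (τ : Set 𝒢) (a b : F.S) : Prop := ∃ s t, F.cls s = a ∧ F.cls t = b ∧ s.AccE τ t

theorem relK_of_accK {i : 𝒜} (hi : i ∈ A) {s t : Mcs Ax} (h : s.AccK i t) :
    F.relK i (F.cls s) (F.cls t) := by
  intro χ hχ
  rw [F.K_mem_rep hi hχ, F.K_mem_rep hi hχ, F.mem_rep hχ]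
  refine ⟨h χ, fun h4 hs => h _ (Mcs.imp_mem.1 (s.provable_mem (.ax (h4 ⟨i, χ, rfl⟩))) hs),
    fun h5 ht => ?_⟩
  by_contra hs
  exact Mcs.neg_mem.1 (h _ (Mcs.imp_mem.1 (s.provable_mem (.ax (h5 ⟨i, χ, rfl⟩)))
    (Mcs.neg_mem.2 hs))) ht

theorem relK_refl (hK2 : axK2 ⊆ Ax) (i : 𝒜) (a : F.S) : F.relK i a a := fun χ _ =>
  ⟨Mcs.imp_mem.1 ((F.rep a).provable_mem (.ax (hK2 ⟨i, χ, rfl⟩))), fun _ => id, fun _ => id⟩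

theorem relK_trans (hK4 : axK4 ⊆ Ax) {i : 𝒜} {a b c : F.S} (hab : F.relK i a b)
    (hbc : F.relK i b c) : F.relK i a c := fun χ hχ =>
  ⟨fun h => (hbc χ hχ).1 ((hab χ hχ).2.1 hK4 h),
    fun _ h => (hbc χ hχ).2.1 hK4 ((hab χ hχ).2.1 hK4 h),
    fun h5 h => (hab χ hχ).2.2 h5 ((hbc χ hχ).2.2 h5 h)⟩

theorem relK_eucl (hK4 : axK4 ⊆ Ax) (hK5 : axK5 ⊆ Ax) {i : 𝒜} {a b c : F.S}
    (hab : F.relK i a b) (hac : F.relK i a c) : F.relK i b c := fun χ hχ =>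
  ⟨fun h => (hac χ hχ).1 ((hab χ hχ).2.2 hK5 h),
    fun _ h => (hac χ hχ).2.1 hK4 ((hab χ hχ).2.2 hK5 h),
    fun _ h => (hab χ hχ).2.1 hK4 ((hac χ hχ).2.2 hK5 h)⟩

theorem relK_serial (hK : sysK Φ 𝒜 𝒢 ⊆ Ax) (hK3 : axK3 ⊆ Ax) (φ₀ : Form Φ 𝒜 𝒢) {i : 𝒜}
    (hi : i ∈ A) (a : F.S) : ∃ b, F.relK i a b := by
  obtain ⟨t, ht, -⟩ := Mcs.exists_accK hK
    (Mcs.neg_mem.1 ((F.rep a).provable_mem (.ax (hK3 ⟨i, φ₀, rfl⟩))))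
  exact ⟨F.cls t, by simpa only [F.cls_rep] using F.relK_of_accK hi ht⟩

theorem relE_refl (hK : sysK Φ 𝒜 𝒢 ⊆ Ax) (hK2 : axK2 ⊆ Ax) (𝒢₀ : Set 𝒢) (i : 𝒜) (a : F.S) :
    F.relE (groupType 𝒢₀ i) a a :=
  ⟨F.rep a, F.rep a, F.cls_rep a, F.cls_rep a, fun _ hG χ h =>
    Mcs.imp_mem.1 ((F.rep a).provable_mem (.ax (hK2 ⟨i, χ, rfl⟩))) (Mcs.K_mem_of_E_mem hK hG.2 h)⟩

theorem relE_symm (hE6 : axE6 ⊆ Ax) {τ : Set 𝒢} {a b : F.S} (h : F.relE τ a b) :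
    F.relE τ b a := by
  obtain ⟨s, t, rfl, rfl, h⟩ := h
  refine ⟨t, s, rfl, rfl, fun G hG χ ht => ?_⟩
  by_contra hs
  exact Mcs.neg_mem.1 (h G hG _ (Mcs.imp_mem.1 (s.provable_mem (.ax (hE6 ⟨G, χ, rfl⟩)))
    (Mcs.neg_mem.2 hs))) ht

theorem relE_target_refl (hE4 : axE4 ⊆ Ax) {τ : Set 𝒢} {a b : F.S} (h : F.relE τ a b) :
    F.relE τ b b := by
  obtain ⟨s, t, rfl, rfl, h⟩ := h
  exact ⟨t, t, rfl, rfl, fun G hG χ =>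
    Mcs.imp_mem.1 (h G hG _ (s.provable_mem (.ax (hE4 ⟨G, χ, rfl⟩))))⟩

theorem relE_serial (hK : sysK Φ 𝒜 𝒢 ⊆ Ax) (hK3 : axK3 ⊆ Ax) (φ₀ : Form Φ 𝒜 𝒢) (𝒢₀ : Set 𝒢)
    (i : 𝒜) (a : F.S) : ∃ b, F.relE (groupType 𝒢₀ i) a b := by
  obtain ⟨t, ht, -⟩ := Mcs.exists_accK hK
    (Mcs.neg_mem.1 ((F.rep a).provable_mem (.ax (hK3 ⟨i, φ₀, rfl⟩))))
  exact ⟨F.cls t, F.rep a, t, F.cls_rep a, rfl, fun G hG χ h =>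
    ht χ (Mcs.K_mem_of_E_mem hK hG.2 h)⟩

/-! ### The truth lemma -/

/-- The structure on pairs of a class and a label that has the given accessibility relations;
labels do not affect the primitive propositions. -/
def kripke {L : Type w} (rel : 𝒜 → F.S × L → F.S × L → Prop) : Kripke.{u, v, w} Φ 𝒜 where
  State := F.S × L
  val x p := Form.atom p ∈ F.rep x.1
  rel := rel

/-- The relations `rel` project to the relations that the filtration prescribes: the agents in `A`
follow `relK`, and for `G ∈ 𝒢₀` the agents of `G` together reach, from every label, each class
that is `E_G`-accessible, and reach only classes that contain each `χ ∈ Cl` with `E_G χ` in the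
source. -/
structure IsAdequate (𝒢₀ : Set 𝒢) {L : Type w} (rel : 𝒜 → F.S × L → F.S × L → Prop) : Prop where
  rel_iff : ∀ i ∈ A, ∀ x y, rel i x y ↔ F.relK i x.1 y.1
  exists_rel : ∀ G ∈ 𝒢₀, ∀ s t : Mcs Ax, s.AccE {G} t → ∀ l, ∃ i ∈ G.1, ∃ l',
    rel i (F.cls s, l) (F.cls t, l')
  mem_of_rel : ∀ G ∈ 𝒢₀, ∀ i ∈ G.1, ∀ x y, rel i x y → ∀ χ ∈ Cl,
    (∀ s, F.cls s = x.1 → Form.E G χ ∈ s) → χ ∈ F.rep y.1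

section TruthLemma

variable {F} {𝒢₀ : Set 𝒢} {L : Type w} {rel : 𝒜 → F.S × L → F.S × L → Prop}

/-- The formula `δ` that defines the set of classes over which `C_G ψ` is true at some label implies
`E_G (ψ ∧ δ)`: an `E_G`-accessible class is reached from that label by one step. So RC1 yields
that `δ` implies `C_G ψ`. -/
theorem IsAdequate.C_mem_of_sat (hK : sysK Φ 𝒜 𝒢 ⊆ Ax) (hrel : F.IsAdequate 𝒢₀ rel)
    {G : 𝒢} (hG : G ∈ 𝒢₀) {ψ : Form Φ 𝒜 𝒢} (hψ : ψ ∈ Cl)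
    (ih : ∀ x : F.S × L, (F.kripke rel).Sat ψ x ↔ ψ ∈ F.rep x.1) (x : F.S × L)
    (h : (F.kripke rel).Sat (.C G ψ) x) : Form.C G ψ ∈ F.rep x.1 := by
  obtain ⟨δ, hδ⟩ := F.definable {a | ∃ l : L, (F.kripke rel).Sat (.C G ψ) (a, l)}
  refine Mcs.imp_mem.1 ((F.rep x.1).provable_mem (.rc1 (φ := δ) G ?_))
    ((hδ _).2 ⟨x.2, by rw [F.cls_rep]; exact h⟩)
  refine provable_of_forall_mcs hK fun s => Mcs.imp_mem.2 fun hs => ?_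
  by_contra hE
  obtain ⟨u, hu, hnot⟩ := Mcs.exists_accE hK hE
  obtain ⟨l, hl⟩ := (hδ s).1 hs
  obtain ⟨i, hi, l', hr⟩ := hrel.exists_rel G hG s u hu l
  refine hnot (Mcs.and_mem.2 ⟨?_, (hδ u).2 ⟨l', fun k => ?_⟩⟩)
  · rw [← F.mem_rep hψ]
    exact (ih (F.cls u, l')).1 (hl 0 i hi _ hr)
  · have := hl (k + 1)
    rw [Function.iterate_succ_apply'] at this
    exact this i hi _ hr

theorem IsAdequate.sat_C_of_mem (hK : sysK Φ 𝒜 𝒢 ⊆ Ax) (hrel : F.IsAdequate 𝒢₀ rel)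
    {G : 𝒢} (hG : G ∈ 𝒢₀) {ψ : Form Φ 𝒜 𝒢} (hψ : ψ ∈ Cl) (hC : Form.C G ψ ∈ Cl)
    (ih : ∀ x : F.S × L, (F.kripke rel).Sat ψ x ↔ ψ ∈ F.rep x.1) (x : F.S × L)
    (h : Form.C G ψ ∈ F.rep x.1) : (F.kripke rel).Sat (.C G ψ) x := by
  have step : ∀ x : F.S × L, Form.C G ψ ∈ F.rep x.1 → ∀ i ∈ G.1, ∀ y, rel i x y →
      ψ ∈ F.rep y.1 ∧ Form.C G ψ ∈ F.rep y.1 := by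
    intro x h i hi y hr
    have hE : ∀ s, F.cls s = x.1 → Form.E G (ψ.and (.C G ψ)) ∈ s := fun s hs =>
      Mcs.E_and_C_mem hK (by rwa [← hs, F.mem_rep hC] at h)
    exact ⟨hrel.mem_of_rel G hG i hi x y hr _ hψ fun s hs =>
        Mcs.E_mono hK (fun t ht => (Mcs.and_mem.1 ht).1) (hE s hs),
      hrel.mem_of_rel G hG i hi x y hr _ hC fun s hs =>
        Mcs.E_mono hK (fun t ht => (Mcs.and_mem.1 ht).2) (hE s hs)⟩
  intro k
  induction k generalizing x with
  | zero => exact fun i hi y hr => (ih y).2 (step x h i hi y hr).1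
  | succ k ihk =>
    rw [Function.iterate_succ_apply']
    exact fun i hi y hr => ihk y (step x h i hi y hr).2

theorem IsAdequate.sat_iff (hK : sysK Φ 𝒜 𝒢 ⊆ Ax) (hF : IsFragment Cl A 𝒢₀)
    (hrel : F.IsAdequate 𝒢₀ rel) (φ : Form Φ 𝒜 𝒢) (hφ : φ ∈ Cl) (x : F.S × L) :
    (F.kripke rel).Sat φ x ↔ φ ∈ F.rep x.1 := by
  induction φ generalizing x with
  | atom p => exact Iff.rfl
  | and φ ψ ih₁ ih₂ =>
    have := hF.and _ _ hφ
    rw [Mcs.and_mem, ← ih₁ this.1, ← ih₂ this.2]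
    rfl
  | neg φ ih =>
    rw [Mcs.neg_mem, ← ih (hF.neg _ hφ)]
    rfl
  | K i ψ ih =>
    obtain ⟨hψ, hi⟩ := hF.K _ _ hφ
    constructor
    · intro h
      by_contra hn
      obtain ⟨t, ht, hnot⟩ := Mcs.exists_accK hK hn
      have hr := F.relK_of_accK hi ht
      rw [F.cls_rep] at hr
      exact hnot ((F.mem_rep hψ).1 ((ih hψ (F.cls t, x.2)).1
        (h _ ((hrel.rel_iff i hi x (F.cls t, x.2)).2 hr))))
    · exact fun h y hr => (ih hψ y).2 (((hrel.rel_iff i hi x y).1 hr ψ hψ).1 h)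
  | E G ψ ih =>
    obtain ⟨hψ, hG⟩ := hF.E _ _ hφ
    constructor
    · intro h
      by_contra hn
      obtain ⟨t, ht, hnot⟩ := Mcs.exists_accE hK hn
      obtain ⟨i, hi, l, hr⟩ := hrel.exists_rel G hG _ t ht x.2
      rw [F.cls_rep] at hr
      exact hnot ((F.mem_rep hψ).1 ((ih hψ (F.cls t, l)).1 (h i hi _ hr)))
    · exact fun h i hi y hr => (ih hψ y).2 (hrel.mem_of_rel G hG i hi x y hr ψ hψ fun s hs => by
        rwa [← hs, F.mem_rep hφ] at h)
  | C G ψ ih =>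
    obtain ⟨hψ, hG⟩ := hF.C _ _ hφ
    exact ⟨hrel.C_mem_of_sat hK hG hψ (ih hψ) x, hrel.sat_C_of_mem hK hG hψ hφ (ih hψ) x⟩

end TruthLemma
end Filtration

/-! ### Realizing types by infinitely many agents -/

/-- The finitely many agents in `A` can be enlarged to a finite set outside of which every group
type that occurs does so infinitely often. -/
theorem exists_finite_superset {A : Set 𝒜} (hA : A.Finite) {𝒢₀ : Set 𝒢} (h𝒢₀ : 𝒢₀.Finite) :
    ∃ A', A'.Finite ∧ A ⊆ A' ∧
      ∀ i ∉ A', {j | j ∉ A' ∧ groupType 𝒢₀ j = groupType 𝒢₀ i}.Infinite := by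
  set B : Set 𝒜 := {i | {j | groupType 𝒢₀ j = groupType 𝒢₀ i}.Finite} with hB
  have hBfin : B.Finite := by
    have hT : (groupType 𝒢₀ '' B).Finite :=
      h𝒢₀.finite_subsets.subset (by rintro τ ⟨i, -, rfl⟩; exact Set.sep_subset _ _)
    refine (hT.biUnion (t := fun τ => {j | groupType 𝒢₀ j = τ}) ?_).subset fun i hi =>
      Set.mem_biUnion (Set.mem_image_of_mem _ hi) rfl
    rintro τ ⟨i, hi, rfl⟩
    exact hi
  refine ⟨A ∪ B, hA.union hBfin, Set.subset_union_left, fun i hi hfin => hi (.inr ?_)⟩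
  refine ((hA.union hBfin).union hfin).subset fun j hj => ?_
  by_cases h : j ∈ A ∪ B
  · exact .inl h
  · exact .inr ⟨h, hj⟩

/-- Agents can be coloured with finitely many colours so that every colour occurs in every group
type outside `A`. -/
theorem exists_colouring {A : Set 𝒜} {𝒢₀ : Set 𝒢} (C : Type w) [Finite C] [Nonempty C]
    (hinf : ∀ i ∉ A, {j | j ∉ A ∧ groupType 𝒢₀ j = groupType 𝒢₀ i}.Infinite) :
    ∃ col : 𝒜 → C, ∀ i ∉ A, ∀ c, ∃ j ∉ A, groupType 𝒢₀ j = groupType 𝒢₀ i ∧ col j = c := by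
  have : ∀ τ : Set 𝒢, ∃ f : 𝒜 → C, (∃ i ∉ A, groupType 𝒢₀ i = τ) →
      ∀ c, ∃ j ∉ A, groupType 𝒢₀ j = τ ∧ f j = c := by
    intro τ
    by_cases h : ∃ i ∉ A, groupType 𝒢₀ i = τ
    · obtain ⟨i, hi, rfl⟩ := h
      have := (hinf i hi).to_subtype
      obtain ⟨n, ⟨e⟩⟩ := Finite.exists_equiv_fin C
      let g : C → 𝒜 := fun c => (Infinite.natEmbedding _ (e c : ℕ) :
        {j | j ∉ A ∧ groupType 𝒢₀ j = groupType 𝒢₀ i})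
      have hg : g.Injective := fun c d h => e.injective (Fin.val_injective
        ((Infinite.natEmbedding _).injective (Subtype.val_injective h)))
      have hgm : ∀ c, g c ∉ A ∧ groupType 𝒢₀ (g c) = groupType 𝒢₀ i := fun c => Subtype.prop
        (Infinite.natEmbedding {j | j ∉ A ∧ groupType 𝒢₀ j = groupType 𝒢₀ i} (e c : ℕ))
      exact ⟨Function.invFun g, fun _ c => ⟨g c, (hgm c).1, (hgm c).2,
        Function.leftInverse_invFun hg c⟩⟩
    · exact ⟨fun _ => Classical.arbitrary C, fun h' => (h h').elim⟩
  choose f hf using this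
  refine ⟨fun j => f (groupType 𝒢₀ j) j, fun i hi c => ?_⟩
  obtain ⟨j, hj, hτ, hc⟩ := hf _ ⟨i, hi, rfl⟩ c
  exact ⟨j, hj, hτ, by simpa only [hτ] using hc⟩

/-- `Realizes Q R`: the coloured relations `Q c` on classes with labels have together the
projection `R`, from every label. -/
structure Realizes {S L C : Type w} (Q : C → S × L → S × L → Prop) (R : S → S → Prop) : Prop where
  sub : ∀ c x y, Q c x y → R x.1 y.1
  exists_rel : ∀ x t, R x.1 t → ∃ c l, Q c x (t, l)

/-- Completeness for the class of structures whose accessibility relations have the property `Fr`: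
it suffices that the relations `relK` have this property after labelling, and that the relations
`relE` are realized by families of relations with this property. -/
theorem complete_of_realizes (h𝒢 : ∀ G ∈ 𝒢, G.Nonempty) (hK : sysK Φ 𝒜 𝒢 ⊆ Ax)
    (Fr : ∀ X : Type w, (X → X → Prop) → Prop) {𝓜 : Set (Kripke.{u, v, w} Φ 𝒜)}
    (h𝓜 : ∀ M : Kripke.{u, v, w} Φ 𝒜, (∀ i, Fr M.State (M.rel i)) → M ∈ 𝓜)
    (hlift : ∀ (S L : Type w) (R : S → S → Prop), Nonempty L → Fr S R →
      Fr (S × L) fun x y => R x.1 y.1)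
    (hrelK : ∀ {Cl : Set (Form Φ 𝒜 𝒢)} {A} (F : Filtration.{u, v, w} Ax Cl A),
      Form Φ 𝒜 𝒢 → ∀ i ∈ A, Fr F.S (F.relK i))
    (hrelE : ∀ {Cl : Set (Form Φ 𝒜 𝒢)} {A} (F : Filtration.{u, v, w} Ax Cl A),
      Form Φ 𝒜 𝒢 → Nonempty F.S → ∃ L C : Type w, Nonempty L ∧ Nonempty C ∧ Finite C ∧
        ∀ (𝒢₀ : Set 𝒢) (i : 𝒜), ∃ Q : C → F.S × L → F.S × L → Prop,
          Realizes Q (F.relE (groupType 𝒢₀ i)) ∧ ∀ c, Fr _ (Q c)) :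
    Complete Ax 𝓜 := by
  intro φ hvalid
  by_contra hφ
  obtain ⟨s, hs⟩ : ∃ s : Mcs Ax, φ ∉ s := by
    by_contra! h
    exact hφ (provable_of_forall_mcs hK h)
  obtain ⟨Cl, A₀, 𝒢₀, hCl, hA₀, h𝒢₀, hφCl, hfrag⟩ := exists_fragment φ
  obtain ⟨A, hA, hAA, hinf⟩ := exists_finite_superset hA₀ h𝒢₀
  have hfrag : IsFragment Cl A 𝒢₀ :=
    { hfrag with K := fun i ψ h => (hfrag.K i ψ h).imp id fun hi => hAA hi }
  obtain ⟨F⟩ := exists_filtration.{u, v, w} (Ax := Ax) φ hCl hA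
  obtain ⟨L, C, hL, hC, hCfin, hQ⟩ := hrelE F φ ⟨F.cls s⟩
  have hQ' : ∀ τ, ∃ Q : C → F.S × L → F.S × L → Prop, (∃ i, groupType 𝒢₀ i = τ) →
      Realizes Q (F.relE τ) ∧ ∀ c, Fr _ (Q c) := fun τ => by
    by_cases h : ∃ i, groupType 𝒢₀ i = τ
    · obtain ⟨i, rfl⟩ := h
      exact (hQ 𝒢₀ i).imp fun _ hQ _ => hQ
    · exact ⟨fun _ _ _ => False, fun h' => (h h').elim⟩
  choose Q hQ using hQ'
  obtain ⟨col, hcol⟩ := exists_colouring C hinf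
  let rel : 𝒜 → F.S × L → F.S × L → Prop := fun i x y =>
    (i ∈ A ∧ F.relK i x.1 y.1) ∨ (i ∉ A ∧ Q (groupType 𝒢₀ i) (col i) x y)
  have rel_of_mem : ∀ i ∈ A, rel i = fun x y => F.relK i x.1 y.1 := fun i hi => by
    ext x y; simp [rel, hi]
  have rel_of_notMem : ∀ i ∉ A, rel i = Q (groupType 𝒢₀ i) (col i) := fun i hi => by
    ext x y; simp [rel, hi]
  have hrel : F.IsAdequate 𝒢₀ rel := by
    refine ⟨fun i hi x y => by rw [rel_of_mem i hi], fun G hG s t hst l => ?_,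
      fun G hG i hi x y hr χ hχ hE => ?_⟩
    · obtain ⟨i, hi, ⟨hiA, hK⟩ | ⟨hiA, hE⟩⟩ :=
        hst.exists_agent hK hA h𝒢₀ (h𝒢 G.1 G.2)
      · exact ⟨i, hi, l, by rw [rel_of_mem i hiA]; exact F.relK_of_accK hiA hK⟩
      · obtain ⟨c, l', hc⟩ := (hQ _ ⟨i, rfl⟩).1.exists_rel (F.cls s, l) (F.cls t)
          ⟨s, t, rfl, rfl, hE⟩
        obtain ⟨j, hjA, hj, rfl⟩ := hcol i hiA c
        have hGi : G ∈ groupType 𝒢₀ i := ⟨hG, hi⟩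
        rw [← hj] at hc hGi
        exact ⟨j, hGi.2, l', by rw [rel_of_notMem j hjA]; exact hc⟩
    · by_cases hiA : i ∈ A
      · rw [rel_of_mem i hiA] at hr
        exact (hr χ hχ).1 (Mcs.K_mem_of_E_mem hK hi (hE _ (F.cls_rep _)))
      · rw [rel_of_notMem i hiA] at hr
        obtain ⟨s, t, hs, ht, hst⟩ := (hQ _ ⟨i, rfl⟩).1.sub _ _ _ hr
        rw [← ht, F.mem_rep hχ]
        exact hst G ⟨hG, hi⟩ χ (hE s hs)
  have hM : F.kripke rel ∈ 𝓜 := h𝓜 _ fun i => by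
    by_cases hiA : i ∈ A
    · change Fr (F.S × L) (rel i)
      rw [rel_of_mem i hiA]
      exact hlift _ _ _ hL (hrelK F φ i hiA)
    · change Fr (F.S × L) (rel i)
      rw [rel_of_notMem i hiA]
      exact (hQ _ ⟨i, rfl⟩).2 _
  have := (hrel.sat_iff hK hfrag φ hφCl (F.cls s, Classical.arbitrary L)).1 (hvalid _ hM _)
  exact hs ((F.mem_rep hφCl).1 this)

/-! ### The frame conditions -/

section Frames

variable {S : Type w} {R : S → S → Prop}

/-- Without transitivity the type relation itself can be given to every agent. -/
theorem realizes_self (R : S → S → Prop) :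
    Realizes (L := PUnit) (C := PUnit) (fun _ x y => R x.1 y.1) R :=
  ⟨fun _ _ _ h => h, fun _ _ h => ⟨⟨⟩, ⟨⟩, h⟩⟩

/-- The identity together with the one pair `c`, if it belongs to `R`. -/
def pairRel (R : S → S → Prop) (c : S × S) (x y : S × PUnit.{w + 1}) : Prop :=
  x = y ∨ (R c.1 c.2 ∧ x.1 = c.1 ∧ y.1 = c.2)

/-- A reflexive relation is the union of reflexive and transitive relations. -/
theorem realizes_pairRel (h : ∀ a, R a a) : Realizes (pairRel R) R := by
  refine ⟨?_, fun x t ht => ⟨(x.1, t), ⟨⟩, .inr ⟨ht, rfl, rfl⟩⟩⟩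
  rintro c x y (rfl | ⟨hc, hx, hy⟩)
  · exact h _
  · rwa [hx, hy]

theorem pairRel_trans {c : S × S} {x y z : S × PUnit.{w + 1}} (h₁ : pairRel R c x y)
    (h₂ : pairRel R c y z) : pairRel R c x z := by
  rcases h₁ with rfl | ⟨hc, hx, hy⟩
  · exact h₂
  · rcases h₂ with rfl | ⟨-, -, hz⟩
    · exact .inr ⟨hc, hx, hy⟩
    · exact .inr ⟨hc, hx, hz⟩

/-- The equivalence relation generated by the one pair `c`, if it belongs to `R`. -/
def symmPairRel (R : S → S → Prop) (c : S × S) (x y : S × PUnit.{w + 1}) : Prop :=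
  x = y ∨ (R c.1 c.2 ∧ (x.1 = c.1 ∨ x.1 = c.2) ∧ (y.1 = c.1 ∨ y.1 = c.2))

/-- A reflexive and symmetric relation is the union of equivalence relations. -/
theorem realizes_symmPairRel (h : ∀ a, R a a) (hs : ∀ a b, R a b → R b a) :
    Realizes (symmPairRel R) R := by
  refine ⟨?_, fun x t ht => ⟨(x.1, t), ⟨⟩, .inr ⟨ht, .inl rfl, .inr rfl⟩⟩⟩
  rintro c x y (rfl | ⟨hc, hx | hx, hy | hy⟩)
  · exact h _
  all_goals rw [hx, hy]
  exacts [h _, hc, hs _ _ hc, h _]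

theorem symmPairRel_symm {c : S × S} {x y : S × PUnit.{w + 1}} (h : symmPairRel R c x y) :
    symmPairRel R c y x :=
  h.imp Eq.symm fun ⟨hc, hx, hy⟩ => ⟨hc, hy, hx⟩

theorem symmPairRel_trans {c : S × S} {x y z : S × PUnit.{w + 1}} (h₁ : symmPairRel R c x y)
    (h₂ : symmPairRel R c y z) : symmPairRel R c x z := by
  rcases h₁ with rfl | ⟨hc, hx, hy⟩
  · exact h₂
  · rcases h₂ with rfl | ⟨-, -, hz⟩
    · exact .inr ⟨hc, hx, hy⟩
    · exact .inr ⟨hc, hx, hz⟩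

/-- The map that sends a state to the successor with index `c` and gives it the label `c`, except
that a state with a reflexive class that already carries this label stays where it is. -/
noncomputable def labelStep (R : S → S → Prop) (d : S → S) (c : S × ULift.{w} Bool)
    (x : S × (S × ULift.{w} Bool)) : S × (S × ULift.{w} Bool) :=
  open Classical in
  if R x.1 x.1 ∧ x.2 = c then x else (if R x.1 c.1 then c.1 else d x.1, c)

section LabelStep

variable {d : S → S} (hd : ∀ a, R a (d a))
include hd

theorem rel_labelStep (c : S × ULift.{w} Bool) (x : S × (S × ULift.{w} Bool)) :
    R x.1 (labelStep R d c x).1 := by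
  unfold labelStep
  split_ifs with h h'
  exacts [h.1, h', hd _]

theorem labelStep_labelStep (hR : ∀ a b, R a b → R b b) (c : S × ULift.{w} Bool)
    (x : S × (S × ULift.{w} Bool)) :
    labelStep R d c (labelStep R d c x) = labelStep R d c x := by
  have h₁ : (labelStep R d c x).2 = c := by
    unfold labelStep
    split_ifs with h
    exacts [h.2, rfl, rfl]
  conv_lhs => unfold labelStep
  exact if_pos ⟨hR _ _ (rel_labelStep hd c x), h₁⟩

/-- A serial relation all of whose targets are reflexive is, up to labels, the union of idempotent
functions. Each successor has two indices, so that one of them differs from the given label. -/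
theorem realizes_labelStep : Realizes (fun c x y => y = labelStep R d c x) R := by
  refine ⟨fun c x y h => h ▸ rel_labelStep hd c x, fun x t ht => ?_⟩
  obtain ⟨b, hb⟩ : ∃ b : ULift.{w} Bool, x.2 ≠ (t, b) := by
    by_contra! h
    have := (h ⟨true⟩).symm.trans (h ⟨false⟩)
    simp at this
  refine ⟨(t, b), (t, b), ?_⟩
  rw [labelStep, if_neg fun h => hb h.2, if_pos ht]

end LabelStep
end Frames

theorem complete_sysK (h𝒢 : ∀ G ∈ 𝒢, G.Nonempty) :
    Complete (sysK Φ 𝒜 𝒢) (classAll.{u, v, w} Φ 𝒜) :=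
  complete_of_realizes h𝒢 subset_rfl (fun _ _ => True) (fun _ _ => trivial)
    (fun _ _ _ _ _ => trivial) (fun _ _ _ _ => trivial) fun _ _ _ =>
      ⟨PUnit, PUnit, ⟨⟨⟩⟩, ⟨⟨⟩⟩, inferInstance, fun _ _ => ⟨_, realizes_self _, fun _ => trivial⟩⟩

theorem complete_sysT (h𝒢 : ∀ G ∈ 𝒢, G.Nonempty) :
    Complete (sysT Φ 𝒜 𝒢) (classR.{u, v, w} Φ 𝒜) := by
  have hK : sysK Φ 𝒜 𝒢 ⊆ sysT Φ 𝒜 𝒢 := fun _ h => .inl h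
  have hK2 : axK2 ⊆ sysT Φ 𝒜 𝒢 := fun _ h => .inr h
  exact complete_of_realizes h𝒢 hK (fun _ R => ∀ s, R s s) (fun _ h => h)
    (fun _ _ _ _ h s => h s.1) (fun F _ i _ => F.relK_refl hK2 i) fun F _ _ =>
      ⟨PUnit, PUnit, ⟨⟨⟩⟩, ⟨⟨⟩⟩, inferInstance, fun 𝒢₀ i => ⟨_, realizes_self _, fun _ x =>
        F.relE_refl hK hK2 𝒢₀ i x.1⟩⟩

theorem complete_sysS4 (h𝒢 : ∀ G ∈ 𝒢, G.Nonempty) :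
    Complete (sysS4 Φ 𝒜 𝒢) (classRT.{u, v, w} Φ 𝒜) := by
  have hK : sysK Φ 𝒜 𝒢 ⊆ sysS4 Φ 𝒜 𝒢 := fun _ h => .inl (.inl h)
  have hK2 : axK2 ⊆ sysS4 Φ 𝒜 𝒢 := fun _ h => .inl (.inr h)
  have hK4 : axK4 ⊆ sysS4 Φ 𝒜 𝒢 := fun _ h => .inr h
  exact complete_of_realizes h𝒢 hK
    (fun _ R => (∀ s, R s s) ∧ ∀ s t r, R s t → R t r → R s r) (fun _ h => h)
    (fun _ _ _ _ h => ⟨fun s => h.1 s.1, fun s t r => h.2 s.1 t.1 r.1⟩)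
    (fun F _ i _ => ⟨F.relK_refl hK2 i, fun _ _ _ => F.relK_trans hK4⟩) fun F _ _ =>
      ⟨PUnit, F.S × F.S, inferInstance, inferInstance, inferInstance, fun 𝒢₀ i =>
        ⟨_, realizes_pairRel (F.relE_refl hK hK2 𝒢₀ i),
          fun c => ⟨fun _ => .inl rfl, fun _ _ _ => pairRel_trans⟩⟩⟩

theorem complete_sysS5 (h𝒢 : ∀ G ∈ 𝒢, G.Nonempty) :
    Complete (sysS5 Φ 𝒜 𝒢) (classRST.{u, v, w} Φ 𝒜) := by
  have hK : sysK Φ 𝒜 𝒢 ⊆ sysS5 Φ 𝒜 𝒢 := fun _ h => .inl (.inl (.inl (.inl h)))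
  have hK2 : axK2 ⊆ sysS5 Φ 𝒜 𝒢 := fun _ h => .inl (.inl (.inl (.inr h)))
  have hK4 : axK4 ⊆ sysS5 Φ 𝒜 𝒢 := fun _ h => .inl (.inl (.inr h))
  have hK5 : axK5 ⊆ sysS5 Φ 𝒜 𝒢 := fun _ h => .inl (.inr h)
  have hE6 : axE6 ⊆ sysS5 Φ 𝒜 𝒢 := fun _ h => .inr h
  exact complete_of_realizes h𝒢 hK
    (fun _ R => (∀ s, R s s) ∧ (∀ s t, R s t → R t s) ∧ ∀ s t r, R s t → R t r → R s r)
    (fun _ h => h)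
    (fun _ _ _ _ h => ⟨fun s => h.1 s.1, fun s t => h.2.1 s.1 t.1,
      fun s t r => h.2.2 s.1 t.1 r.1⟩)
    (fun F _ i _ => ⟨F.relK_refl hK2 i,
      fun s _ h => F.relK_eucl hK4 hK5 h (F.relK_refl hK2 i s),
      fun _ _ _ => F.relK_trans hK4⟩) fun F _ _ =>
      ⟨PUnit, F.S × F.S, inferInstance, inferInstance, inferInstance, fun 𝒢₀ i =>
        ⟨_, realizes_symmPairRel (F.relE_refl hK hK2 𝒢₀ i) fun _ _ => F.relE_symm hE6,
          fun c => ⟨fun _ => .inl rfl, fun _ _ => symmPairRel_symm,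
            fun _ _ _ => symmPairRel_trans⟩⟩⟩

theorem complete_sysKD45 (h𝒢 : ∀ G ∈ 𝒢, G.Nonempty) :
    Complete (sysKD45 Φ 𝒜 𝒢) (classELT.{u, v, w} Φ 𝒜) := by
  have hK : sysK Φ 𝒜 𝒢 ⊆ sysKD45 Φ 𝒜 𝒢 := fun _ h => .inl (.inl (.inl (.inl h)))
  have hK3 : axK3 ⊆ sysKD45 Φ 𝒜 𝒢 := fun _ h => .inl (.inl (.inl (.inr h)))
  have hK4 : axK4 ⊆ sysKD45 Φ 𝒜 𝒢 := fun _ h => .inl (.inl (.inr h))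
  have hK5 : axK5 ⊆ sysKD45 Φ 𝒜 𝒢 := fun _ h => .inl (.inr h)
  have hE4 : axE4 ⊆ sysKD45 Φ 𝒜 𝒢 := fun _ h => .inr h
  refine complete_of_realizes h𝒢 hK
    (fun _ R => (∀ s t r, R s t → R s r → R t r) ∧ (∀ s, ∃ t, R s t) ∧
      ∀ s t r, R s t → R t r → R s r)
    (fun _ h => h)
    (fun _ _ _ ⟨l⟩ h => ⟨fun s t r => h.1 s.1 t.1 r.1,
      fun s => (h.2.1 s.1).elim fun t ht => ⟨(t, l), ht⟩, fun s t r => h.2.2 s.1 t.1 r.1⟩)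
    (fun F φ i hi => ⟨fun _ _ _ => F.relK_eucl hK4 hK5, F.relK_serial hK hK3 φ hi,
      fun _ _ _ => F.relK_trans hK4⟩) fun F φ _ =>
      ⟨F.S × ULift Bool, F.S × ULift Bool, inferInstance, inferInstance, inferInstance,
        fun 𝒢₀ i => ?_⟩
  choose d hd using F.relE_serial hK hK3 φ 𝒢₀ i
  have hidem := labelStep_labelStep hd fun _ _ => F.relE_target_refl hE4
  refine ⟨_, realizes_labelStep hd, fun c => ⟨?_, fun x => ⟨_, rfl⟩, ?_⟩⟩
  · rintro x _ _ rfl rfl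
    exact (hidem c x).symm
  · rintro x _ _ rfl rfl
    exact hidem c x

end Completeness

/-! ### Soundness -/

section Soundness

variable {Φ : Type u} {𝒜 : Type v} {𝒢 : Set (Set 𝒜)} (M : Kripke.{u, v, w} Φ 𝒜)

theorem Kripke.sat_imp {φ ψ : Form Φ 𝒜 𝒢} {s : M.State} :
    M.Sat (φ.imp ψ) s ↔ (M.Sat φ s → M.Sat ψ s) := by
  simp [Form.imp, Kripke.Sat]

theorem Kripke.sat_conj {φ : Form Φ 𝒜 𝒢} {l : List (Form Φ 𝒜 𝒢)} {s : M.State} :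
    M.Sat (Form.conj φ l) s ↔ ∀ χ ∈ φ :: l, M.Sat χ s := by
  induction l generalizing φ with
  | nil => simp [Form.conj]
  | cons ψ l ih => rw [Form.conj, Kripke.Sat, ih]; simp

theorem Kripke.sat_subst (σ : ℕ → Form Φ 𝒜 𝒢) (s : M.State) (p : PForm) :
    M.Sat (p.subst σ) s ↔ p.eval fun n => M.Sat (σ n) s := by
  induction p with
  | var n => rfl
  | and p q ih₁ ih₂ => exact and_congr ih₁ ih₂
  | neg p ih => exact not_congr ih

theorem Kripke.sat_of_mem_sysK {φ : Form Φ 𝒜 𝒢} (h : φ ∈ sysK Φ 𝒜 𝒢) (s : M.State) :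
    M.Sat φ s := by
  simp only [sysK, Set.mem_union] at h
  rcases h with ((((⟨p, σ, hp, rfl⟩ | ⟨i, φ, ψ, rfl⟩) | ⟨G, i, φ, hi, rfl⟩) |
    ⟨G, φ, as, gs, ψ, l, hcov, hl, rfl⟩) | ⟨G, φ, ψ, rfl⟩) | ⟨G, φ, rfl⟩
  · exact (M.sat_subst σ s p).2 (hp _)
  · exact M.sat_imp.2 fun h t ht => M.sat_imp.1 (h.2 t ht) (h.1 t ht)
  · exact M.sat_imp.2 fun h t ht => h i hi t ht
  · refine M.sat_imp.2 fun h i hi t ht => ?_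
    rw [M.sat_conj, ← hl] at h
    rcases hcov i hi with hi | ⟨G', hG', hi⟩
    · exact h (.K i φ) (by simp only [List.mem_append, List.mem_map]; exact .inl ⟨i, hi, rfl⟩) t ht
    · exact h (.E G' φ) (by simp only [List.mem_append, List.mem_map]; exact .inr ⟨G', hG', rfl⟩)
        i hi t ht
  · exact M.sat_imp.2 fun h i hi t ht => M.sat_imp.1 (h.2 i hi t ht) (h.1 i hi t ht)
  · refine M.sat_imp.2 fun h i hi t ht => ⟨h 0 i hi t ht, fun k => ?_⟩
    have := h (k + 1)
    rw [Function.iterate_succ_apply'] at this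
    exact this i hi t ht

/-- The rules preserve truth in each structure. -/
theorem sound_of_sat {Ax : Set (Form Φ 𝒜 𝒢)} {𝓜 : Set (Kripke.{u, v, w} Φ 𝒜)}
    (h : ∀ M ∈ 𝓜, ∀ φ ∈ Ax, ∀ s, M.Sat φ s) : Sound Ax 𝓜 := by
  intro φ hφ M hM
  induction hφ with
  | ax hφ => exact h M hM _ hφ
  | mp _ _ ih₁ ih₂ => exact fun s => M.sat_imp.1 (ih₂ s) (ih₁ s)
  | kGen i _ ih => exact fun _ t _ => ih t
  | eGen G _ ih => exact fun _ _ _ t _ => ih t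
  | rc1 G _ ih =>
    refine fun s => M.sat_imp.2 fun hs k => ?_
    induction k generalizing s with
    | zero => exact fun i hi t ht => (M.sat_imp.1 (ih s) hs i hi t ht).1
    | succ k ihk =>
      rw [Function.iterate_succ_apply']
      exact fun i hi t ht => ihk t (M.sat_imp.1 (ih s) hs i hi t ht).2

theorem sound_sysK : Sound (sysK Φ 𝒜 𝒢) (classAll.{u, v, w} Φ 𝒜) :=
  sound_of_sat fun M _ _ h => M.sat_of_mem_sysK h

variable {M}

theorem Kripke.sat_axK2 {φ : Form Φ 𝒜 𝒢} (h : φ ∈ axK2) (hM : ∀ i s, M.rel i s s) (s : M.State) :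
    M.Sat φ s := by
  obtain ⟨i, φ, rfl⟩ := h
  exact M.sat_imp.2 fun h => h s (hM i s)

theorem Kripke.sat_axK4 {φ : Form Φ 𝒜 𝒢} (h : φ ∈ axK4)
    (hM : ∀ i s t r, M.rel i s t → M.rel i t r → M.rel i s r) (s : M.State) : M.Sat φ s := by
  obtain ⟨i, φ, rfl⟩ := h
  exact M.sat_imp.2 fun h t ht r hr => h r (hM i s t r ht hr)

theorem Kripke.sat_axK5 {φ : Form Φ 𝒜 𝒢} (h : φ ∈ axK5)
    (hM : ∀ i s t r, M.rel i s t → M.rel i s r → M.rel i t r) (s : M.State) : M.Sat φ s := by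
  obtain ⟨i, φ, rfl⟩ := h
  exact M.sat_imp.2 fun h t ht ht' => h fun r hr => ht' r (hM i s t r ht hr)

theorem sound_sysT : Sound (sysT Φ 𝒜 𝒢) (classR.{u, v, w} Φ 𝒜) := by
  refine sound_of_sat fun M hM φ hφ => ?_
  rcases hφ with h | h
  exacts [M.sat_of_mem_sysK h, Kripke.sat_axK2 h hM]

theorem sound_sysS4 : Sound (sysS4 Φ 𝒜 𝒢) (classRT.{u, v, w} Φ 𝒜) := by
  refine sound_of_sat fun M hM φ hφ => ?_
  rcases hφ with (h | h) | h
  exacts [M.sat_of_mem_sysK h, Kripke.sat_axK2 h fun i => (hM i).1,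
    Kripke.sat_axK4 h fun i => (hM i).2]

theorem sound_sysS5 : Sound (sysS5 Φ 𝒜 𝒢) (classRST.{u, v, w} Φ 𝒜) := by
  refine sound_of_sat fun M hM φ hφ => ?_
  rcases hφ with (((h | h) | h) | h) | ⟨G, φ, rfl⟩
  · exact M.sat_of_mem_sysK h
  · exact Kripke.sat_axK2 h fun i => (hM i).1
  · exact Kripke.sat_axK4 h fun i => (hM i).2.2
  · exact Kripke.sat_axK5 h fun i s t r hst hsr =>
      (hM i).2.2 t s r ((hM i).2.1 s t hst) hsr
  · exact fun s => M.sat_imp.2 fun h i hi t ht hE => h (hE i hi s ((hM i).2.1 s t ht))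

theorem sound_sysKD45 : Sound (sysKD45 Φ 𝒜 𝒢) (classELT.{u, v, w} Φ 𝒜) := by
  refine sound_of_sat fun M hM φ hφ s => ?_
  rcases hφ with (((h | ⟨i, φ, rfl⟩) | h) | h) | ⟨G, φ, rfl⟩
  · exact M.sat_of_mem_sysK h s
  · obtain ⟨t, ht⟩ := (hM i).2.1 s
    exact fun h => (h t ht).2 (h t ht).1
  · exact Kripke.sat_axK4 h (fun i => (hM i).2.2) s
  · exact Kripke.sat_axK5 h (fun i => (hM i).1) s
  · exact fun i hi t ht => M.sat_imp.2 fun h => h i hi t ((hM i).1 s t t ht ht)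

end Soundness

end CK

theorem theorem3p1 (Φ : Type u) (𝒜 : Type v) (𝒢 : Set (Set 𝒜))
    (h𝒢 : ∀ G ∈ 𝒢, G.Nonempty) :
    (CK.Sound (CK.sysK Φ 𝒜 𝒢) (CK.classAll.{u, v, w} Φ 𝒜) ∧
      CK.Complete (CK.sysK Φ 𝒜 𝒢) (CK.classAll.{u, v, w} Φ 𝒜)) ∧
    (CK.Sound (CK.sysT Φ 𝒜 𝒢) (CK.classR.{u, v, w} Φ 𝒜) ∧
      CK.Complete (CK.sysT Φ 𝒜 𝒢) (CK.classR.{u, v, w} Φ 𝒜)) ∧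
    (CK.Sound (CK.sysS4 Φ 𝒜 𝒢) (CK.classRT.{u, v, w} Φ 𝒜) ∧
      CK.Complete (CK.sysS4 Φ 𝒜 𝒢) (CK.classRT.{u, v, w} Φ 𝒜)) ∧
    (CK.Sound (CK.sysS5 Φ 𝒜 𝒢) (CK.classRST.{u, v, w} Φ 𝒜) ∧
      CK.Complete (CK.sysS5 Φ 𝒜 𝒢) (CK.classRST.{u, v, w} Φ 𝒜)) ∧
    (CK.Sound (CK.sysKD45 Φ 𝒜 𝒢) (CK.classELT.{u, v, w} Φ 𝒜) ∧
      CK.Complete (CK.sysKD45 Φ 𝒜 𝒢) (CK.classELT.{u, v, w} Φ 𝒜)) :=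
  ⟨⟨CK.sound_sysK, CK.complete_sysK h𝒢⟩, ⟨CK.sound_sysT, CK.complete_sysT h𝒢⟩,
    ⟨CK.sound_sysS4, CK.complete_sysS4 h𝒢⟩, ⟨CK.sound_sysS5, CK.complete_sysS5 h𝒢⟩,
    ⟨CK.sound_sysKD45, CK.complete_sysKD45 h𝒢⟩⟩
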